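/- All graphs are finite and simple. The tensor product $G \times H$ of graphs $G$ and $H$ has vertex set $V(G) \times V(H)$, and $(u_1, v_1)$, $(u_2, v_2)$ are adjacent in it if and only if $u_1u_2 \in E(G)$ and $v_1v_2 \in E(H)$. A tree decomposition of a graph $G$ is a finite tree $T$, each node of which carries a set of vertices of $G$ (its bag), such that any two adjacent vertices of $G$ share at least one bag, every vertex of $G$ is in some bag, and a vertex that is in the bags of two nodes is in the bag of every node on the path between them in $T$. Its width is one less than the maximum size of a bag, and the treewidth $\operatorname{tw}(G)$ is the minimum width over all tree decompositions of $G$. Lemma A.10. Let $G$ and $H$ be connected (in particular nonempty) graphs, and suppose that $H$ is not bipartite. Then $$\operatorname{tw}(G \times H) \geq \operatorname{tw}(G).$$ -/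

import Mathlib

namespace SimpleGraph

/-- The tensor product `G × H`: vertex set `V × W`, with `(u₁, v₁)` adjacent to `(u₂, v₂)` exactly
when `u₁ u₂` is an edge of `G` and `v₁ v₂` is an edge of `H`. -/
def tensorProduct {V W : Type*} (G : SimpleGraph V) (H : SimpleGraph W) :
    SimpleGraph (V × W) where
  Adj a b := G.Adj a.1 b.1 ∧ H.Adj a.2 b.2
  symm := ⟨fun _ _ h => ⟨h.1.symm, h.2.symm⟩⟩
  loopless := ⟨fun _ h => h.1.ne rfl⟩

/-- A tree decomposition of `G`: a tree on the node set `ι`, each node of which carries a bag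
(a finite set of vertices of `G`). -/
structure TreeDecomposition {V : Type*} (G : SimpleGraph V) (ι : Type*) where
  /-- The underlying tree. -/
  tree : SimpleGraph ι
  isTree : tree.IsTree
  /-- The bag carried by a node. -/
  bag : ι → Finset V
  /-- Adjacent vertices share a bag. -/
  adj_mem_bag : ∀ u v : V, G.Adj u v → ∃ i, u ∈ bag i ∧ v ∈ bag i
  /-- A vertex lying in two bags lies in every bag on the tree path between them. -/
  mem_bag_of_mem_path : ∀ (v : V) (i j : ι) (p : tree.Walk i j), p.IsPath →
    v ∈ bag i → v ∈ bag j → ∀ k ∈ p.support, v ∈ bag k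
  /-- Every vertex lies in some bag. -/
  exists_mem_bag : ∀ v : V, ∃ i, v ∈ bag i

/-- The width of a tree decomposition: one less than the maximum size of a bag. (The subtraction
truncates only if all bags are empty, that is, only if `G` has no vertices.) -/
def TreeDecomposition.width {V : Type*} {G : SimpleGraph V} {ι : Type*} [Fintype ι]
    (D : G.TreeDecomposition ι) : ℕ :=
  (Finset.univ.sup fun i => (D.bag i).card) - 1

/-- The treewidth of a finite graph: the minimum width over all its (finite) tree decompositions.
The minimum is over a nonempty set, see `exists_treeDecomposition`. -/
noncomputable def treewidth {V : Type*} (G : SimpleGraph V) : ℕ :=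
  sInf {w : ℕ | ∃ (ι : Type) (_ : Fintype ι) (D : G.TreeDecomposition ι), D.width = w}

/-- Every finite graph has a tree decomposition, so that its treewidth is attained. -/
theorem exists_treeDecomposition {V : Type*} [Finite V] (G : SimpleGraph V) :
    ∃ (ι : Type) (_ : Fintype ι) (D : G.TreeDecomposition ι), D.width = G.treewidth := by
  have : Fintype V := Fintype.ofFinite V
  refine Nat.sInf_mem
    (s := {w : ℕ | ∃ (ι : Type) (_ : Fintype ι) (D : G.TreeDecomposition ι), D.width = w})
    ⟨_, Unit, inferInstance, ⟨⊥, IsTree.of_subsingleton, fun _ => Finset.univ, ?_, ?_, ?_⟩, rfl⟩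
  · exact fun _ _ _ => ⟨(), Finset.mem_univ _, Finset.mem_univ _⟩
  · exact fun _ _ _ _ _ _ _ _ _ => Finset.mem_univ _
  · exact fun _ => ⟨(), Finset.mem_univ _⟩

end SimpleGraph

namespace SimpleGraph

/-! The proof goes through tree-width duality: a graph of tree-width `w > 0` has a bramble with no
cover of size at most `w` (`exists_isBramble_forall_covers`), and every bramble has a cover of size
at most the tree-width plus one (`IsBramble.exists_covers_ncard_le`). Let `C` be an odd cycle of
`H`. A bramble of `G` is lifted to the family of all connected sets containing some `B ×ˢ C`.
Suppose `S` with `|S| ≤ w` covers it. The projection of `S` misses some member `B`. If `B` has two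
elements, `B ×ˢ C` is itself connected, since walking to a neighbour and back moves two places
around an odd cycle. If `B = {v}`, the closed neighbourhood of `v` covers the bramble, so `v` has
degree at least `w` and `S` fills the neighbourhood fibre at no more than one position of `C`. The
other positions still connect the copy of `C` over `v` outside `S`. -/

variable {V : Type*} {G : SimpleGraph V}

/-! ### Brambles and covers. -/

/-- A set `B` induces a connected subgraph (or is empty): every set of vertices that meets `B` and
is closed under adjacency within `B` contains `B`. -/
def ConnectedOn (G : SimpleGraph V) (B : Set V) : Prop :=
  ∀ U : Set V, (∃ x ∈ B, x ∈ U) → (∀ a ∈ B, a ∈ U → ∀ b ∈ B, G.Adj a b → b ∈ U) → B ⊆ U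

/-- Two sets of vertices touch if they share a vertex or are joined by an edge. -/
def Touch (G : SimpleGraph V) (B C : Set V) : Prop :=
  ∃ a ∈ B, ∃ b ∈ C, a = b ∨ G.Adj a b

lemma Touch.symm {B C : Set V} (h : G.Touch B C) : G.Touch C B := by
  obtain ⟨a, ha, b, hb, h⟩ := h
  exact ⟨b, hb, a, ha, h.imp Eq.symm fun h => h.symm⟩

/-- A bramble: a family of pairwise touching (in particular nonempty) connected sets. -/
structure IsBramble (G : SimpleGraph V) (𝓑 : Set (Set V)) : Prop where
  connectedOn : ∀ B ∈ 𝓑, G.ConnectedOn B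
  touch : ∀ B ∈ 𝓑, ∀ C ∈ 𝓑, G.Touch B C

/-- `X` covers the family `𝓑` if it meets every member. -/
def Covers (X : Set V) (𝓑 : Set (Set V)) : Prop :=
  ∀ B ∈ 𝓑, ∃ x ∈ B, x ∈ X

/-! ### Decompositions built by gluing. -/

/-- Tree decompositions of induced subgraphs, built by gluing: `G.RootedDecomposition A X 𝒳` says
that the subgraph induced on `A` has a tree decomposition with set of bags `𝒳` and root bag `X`. -/
inductive RootedDecomposition (G : SimpleGraph V) : Set V → Set V → Set (Set V) → Prop
  | leaf (X : Set V) : RootedDecomposition G X X {X}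
  | glue {A B X Y : Set V} {𝒳 𝒴 : Set (Set V)} (hA : RootedDecomposition G A X 𝒳)
      (hB : RootedDecomposition G B Y 𝒴) (hX : A ∩ B ⊆ X) (hY : A ∩ B ⊆ Y)
      (hadj : ∀ a ∈ A, a ∉ B → ∀ b ∈ B, b ∉ A → ¬ G.Adj a b) :
      RootedDecomposition G (A ∪ B) X (𝒳 ∪ 𝒴)

namespace RootedDecomposition

lemma root_mem {A X : Set V} {𝒳 : Set (Set V)} (h : G.RootedDecomposition A X 𝒳) : X ∈ 𝒳 := by
  induction h with
  | leaf X => rfl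
  | glue _ _ _ _ _ ih _ => exact Or.inl ih

lemma subset_of_mem {A X : Set V} {𝒳 : Set (Set V)} (h : G.RootedDecomposition A X 𝒳) :
    ∀ Y ∈ 𝒳, Y ⊆ A := by
  induction h with
  | leaf X => rintro _ rfl; exact subset_rfl
  | glue _ _ _ _ _ ih ih' =>
    rintro Z (hZ | hZ)
    · exact (ih Z hZ).trans Set.subset_union_left
    · exact (ih' Z hZ).trans Set.subset_union_right

lemma root_subset {A X : Set V} {𝒳 : Set (Set V)} (h : G.RootedDecomposition A X 𝒳) : X ⊆ A :=
  h.subset_of_mem X h.root_mem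

/-- A decomposition may be attached at any bag of another one. -/
lemma attach {A B X Y Z : Set V} {𝒳 𝒴 : Set (Set V)} (hA : G.RootedDecomposition A Z 𝒳)
    (hB : G.RootedDecomposition B Y 𝒴) (hX : X ∈ 𝒳) (hAX : A ∩ B ⊆ X) (hY : A ∩ B ⊆ Y)
    (hadj : ∀ a ∈ A, a ∉ B → ∀ b ∈ B, b ∉ A → ¬ G.Adj a b) :
    G.RootedDecomposition (A ∪ B) Z (𝒳 ∪ 𝒴) := by
  induction hA generalizing X with
  | leaf Z => cases hX; exact glue (leaf Z) hB hAX hY hadj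
  | @glue A₁ A₂ X₁ X₂ 𝒳₁ 𝒳₂ h₁ h₂ hX₁ hX₂ hadj' ih₁ ih₂ =>
    rcases hX with hX | hX
    · have hXA := h₁.subset_of_mem X hX
      have h := glue (ih₁ hX (by grind) (by grind) (by grind)) h₂ (by grind) (by grind)
        (by have := fun a b => G.adj_comm a b; grind)
      convert h using 1 <;> grind
    · have hXA := h₂.subset_of_mem X hX
      have h := glue h₁ (ih₂ hX (by grind) (by grind) (by grind)) (by grind) (by grind)
        (by have := fun a b => G.adj_comm a b; grind)
      convert h using 1 <;> grind

/-- If the new root lies in the second half of a `glue`, that half is rerooted and the first half is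
attached at its old root. -/
lemma reroot {A X Z : Set V} {𝒳 : Set (Set V)} (h : G.RootedDecomposition A X 𝒳) (hZ : Z ∈ 𝒳) :
    G.RootedDecomposition A Z 𝒳 := by
  induction h generalizing Z with
  | leaf X => cases hZ; exact leaf X
  | @glue A B X Y 𝒳 𝒴 hA hB hX hY hadj ihA ihB =>
    rcases hZ with hZ | hZ
    · exact (ihA hZ).attach hB hA.root_mem hX hY hadj
    · rw [Set.union_comm A, Set.union_comm 𝒳]
      refine (ihB hZ).attach hA hB.root_mem (by grind) (by grind) ?_
      exact fun a ha ha' b hb hb' h => hadj b hb hb' a ha ha' h.symm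

/-- Restriction of a decomposition to `X ∪ C`, with the vertices of `X` pulled up to the root. -/
lemma pull {P Q : Set V → Prop} {S X C A Y : Set V} {𝒳 : Set (Set V)}
    (hQ : ∀ A Y : Set V, Y ⊆ A → P Y → (∀ a ∈ A, a ∉ Y → ∀ b, G.Adj a b → b ∈ A) → S ∩ A ⊆ Y →
      Q (A ∩ X ∪ Y ∩ C))
    (h : G.RootedDecomposition A Y 𝒳) (hP : ∀ Z ∈ 𝒳, P Z)
    (hA : ∀ a ∈ A, a ∉ Y → ∀ b, G.Adj a b → b ∈ A) (hS : S ∩ A ⊆ Y) :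
    ∃ 𝒴, G.RootedDecomposition (A ∩ (X ∪ C)) (A ∩ X ∪ Y ∩ C) 𝒴 ∧ ∀ Z ∈ 𝒴, Q Z := by
  induction h with
  | leaf Y =>
    refine ⟨{Y ∩ X ∪ Y ∩ C}, ?_, ?_⟩
    · rw [Set.inter_union_distrib_left]; exact leaf _
    · rintro _ rfl
      exact hQ Y Y subset_rfl (hP Y rfl) hA hS
  | @glue A B Y Z 𝒳 𝒴 h₁ h₂ hY hZ hadj ih₁ ih₂ =>
    have hYA := h₁.root_subset
    have hZB := h₂.root_subset
    have hcomm := fun a b => G.adj_comm a b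
    obtain ⟨𝒳', h₁', hQ₁⟩ := ih₁ (fun Z hZ => hP Z (Or.inl hZ))
      (fun a ha haY b hab => by have := hA a (Or.inl ha) haY b hab; grind) (by grind)
    obtain ⟨𝒴', h₂', hQ₂⟩ := ih₂ (fun Z hZ => hP Z (Or.inr hZ))
      (fun a ha haY b hab => by have := hA a (Or.inr ha) (by grind) b hab; grind) (by grind)
    -- The enlarged root bag becomes a new node, from which the pulled forms of both halves hang.
    have hW := hQ (A ∪ B) Y (by grind) (hP Y (Or.inl h₁.root_mem)) hA hS
    have h := glue (glue (leaf ((A ∪ B) ∩ X ∪ Y ∩ C)) h₁' (by grind) (by grind)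
      (by intro a ha ha' b hb hb'; apply hcomm a b |>.not.2; grind)) h₂' (by grind) (by grind) (by grind)
    refine ⟨{(A ∪ B) ∩ X ∪ Y ∩ C} ∪ 𝒳' ∪ 𝒴', ?_, ?_⟩
    · convert h using 1
      grind
    · rintro Z ((rfl | hZ) | hZ)
      exacts [hW, hQ₁ Z hZ, hQ₂ Z hZ]

/-- A bramble is covered by a bag. -/
lemma exists_mem_covers {X : Set V} {𝒳 𝓑 : Set (Set V)}
    (h : G.RootedDecomposition Set.univ X 𝒳) (h𝓑 : G.IsBramble 𝓑) : ∃ Y ∈ 𝒳, Covers Y 𝓑 := by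
  by_contra! hno
  have key : ∀ {A X 𝒳}, G.RootedDecomposition A X 𝒳 →
      (∀ a ∈ A, a ∉ X → ∀ b, G.Adj a b → b ∈ A) → (∀ Y ∈ 𝒳, ¬ Covers Y 𝓑) →
      ∃ B ∈ 𝓑, ∀ x ∈ B, x ∉ A := by
    intro A X 𝒳 h hA hno
    induction h with
    | leaf X => simpa [Covers] using hno X rfl
    | @glue A B Y Z 𝒳 𝒴 h₁ h₂ hY hZ hadj ih₁ ih₂ =>
      have hcomm := fun a b => G.adj_comm a b
      have hYA := h₁.root_subset
      obtain ⟨B₁, hB₁, hd₁⟩ := ih₁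
        (fun a ha haY b hab => by have := hA a (Or.inl ha) haY b hab; grind)
        (fun Z hZ => hno Z (Or.inl hZ))
      obtain ⟨B₂, hB₂, hd₂⟩ := ih₂
        (fun a ha haY b hab => by have := hA a (Or.inr ha) (by grind) b hab; grind)
        (fun Z hZ => hno Z (Or.inr hZ))
      -- If `B₁` met `B`, it would be trapped in `B \ A`, whose neighbours all lie in `B`; but it
      -- touches `B₂`, which avoids `B`.
      refine ⟨B₁, hB₁, fun x hx hxAB => ?_⟩
      have hsub : B₁ ⊆ B := h𝓑.connectedOn B₁ hB₁ B ⟨x, hx, by grind⟩ fun a ha haB b hb hab => by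
        have := hA a (Or.inr haB) (by grind) b hab
        grind
      obtain ⟨a, ha, b, hb, hab⟩ := h𝓑.touch B₁ hB₁ B₂ hB₂
      have haB := hsub ha
      rcases hab with rfl | hab
      · exact hd₂ a hb haB
      · have := hA a (Or.inr haB) (by grind) b hab
        grind
  obtain ⟨B, hB, hd⟩ := key h (fun _ _ _ _ _ => trivial) hno
  obtain ⟨a, ha, -⟩ := h𝓑.touch B hB B hB
  exact hd a ha trivial

end RootedDecomposition

/-! ### Tree-width duality, hard direction. -/

/-- The vertices reachable from `a` by paths avoiding `X` after their first vertex. -/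
def componentAvoiding (G : SimpleGraph V) (X : Set V) (a : V) : Set V :=
  {y | Relation.ReflTransGen (fun b c => G.Adj b c ∧ c ∉ X) a y}

lemma self_mem_componentAvoiding (X : Set V) (a : V) : a ∈ G.componentAvoiding X a :=
  Relation.ReflTransGen.refl

lemma notMem_of_mem_componentAvoiding {X : Set V} {a y : V} (ha : a ∉ X)
    (hy : y ∈ G.componentAvoiding X a) : y ∉ X := by
  rcases Relation.ReflTransGen.cases_tail hy with rfl | ⟨_, _, -, h⟩
  exacts [ha, h]

lemma mem_componentAvoiding_of_adj {X : Set V} {a b c : V} (hb : b ∈ G.componentAvoiding X a)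
    (hbc : G.Adj b c) (hc : c ∉ X) : c ∈ G.componentAvoiding X a :=
  Relation.ReflTransGen.tail hb ⟨hbc, hc⟩

lemma connectedOn_componentAvoiding (X : Set V) (a : V) :
    G.ConnectedOn (G.componentAvoiding X a) := by
  rintro U ⟨x, hx, hxU⟩ hU
  have haU : a ∈ U := by
    induction hx with
    | refl => exact hxU
    | @tail b c hb hbc ih =>
      exact ih (hU c (hb.tail hbc) hxU b hb hbc.1.symm)
  intro y hy
  induction hy with
  | refl => exact haU
  | @tail b c hb hbc ih => exact hU b hb ih c (hb.tail hbc) hbc.1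

namespace RootedDecomposition

/-- Gluing decompositions of the sets `X ∪ C`, for `C` a component of `G - X`, along `X`. -/
lemma of_componentAvoiding [Finite V] {P : Set V → Prop} {X : Set V} (hX : P X)
    (h : ∀ a ∉ X, ∃ 𝒳, G.RootedDecomposition (X ∪ G.componentAvoiding X a) X 𝒳 ∧ ∀ Y ∈ 𝒳, P Y) :
    ∃ 𝒳, G.RootedDecomposition Set.univ X 𝒳 ∧ ∀ Y ∈ 𝒳, P Y := by
  suffices H : ∀ s : Set V, s.Finite → ∃ A 𝒳, X ⊆ A ∧ s ⊆ A ∧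
      (∀ a ∈ A, a ∉ X → ∀ b, G.Adj a b → b ∈ A) ∧
      G.RootedDecomposition A X 𝒳 ∧ ∀ Y ∈ 𝒳, P Y by
    obtain ⟨A, 𝒳, -, hA, -, h𝒳⟩ := H Set.univ Set.finite_univ
    rw [Set.univ_subset_iff] at hA
    exact ⟨𝒳, hA ▸ h𝒳⟩
  intro s hs
  induction s, hs using Set.Finite.induction_on with
  | empty => exact ⟨X, {X}, subset_rfl, by simp, by simp +contextual, leaf X, by simpa⟩
  | @insert a s _ _ ih =>
    obtain ⟨A, 𝒳, hXA, hsA, hA, hd, hP⟩ := ih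
    by_cases haA : a ∈ A
    · exact ⟨A, 𝒳, hXA, Set.insert_subset haA hsA, hA, hd, hP⟩
    have haX : a ∉ X := fun h => haA (hXA h)
    obtain ⟨𝒴, hd', hP'⟩ := h a haX
    have hself := G.self_mem_componentAvoiding X a
    have hCA : ∀ y ∈ G.componentAvoiding X a, y ∉ A := by
      intro y hy
      induction hy with
      | refl => exact haA
      | @tail b c hb hbc ih =>
        exact fun hc => ih (hA c hc hbc.2 b hbc.1.symm)
    have hC : ∀ y ∈ G.componentAvoiding X a, ∀ b, G.Adj y b →
        b ∈ X ∪ G.componentAvoiding X a := fun y hy b hyb => by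
      by_cases hb : b ∈ X
      · exact Or.inl hb
      · exact Or.inr (mem_componentAvoiding_of_adj hy hyb hb)
    refine ⟨A ∪ (X ∪ G.componentAvoiding X a), 𝒳 ∪ 𝒴, by grind, by grind, ?_,
      glue hd hd' (by grind) (by grind) ?_, by grind⟩
    · grind
    · grind

end RootedDecomposition

/-- The exchange argument behind the duality theorem: pulling the vertices of a minimum cover `X`
up to the root does not enlarge a bag. -/
lemma ncard_pull_le [Finite V] {𝓑 : Set (Set V)} {A C S X Y : Set V}
    (h𝓑 : ∀ B ∈ 𝓑, G.ConnectedOn B) (hX : Covers X 𝓑)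
    (hmin : ∀ X', Covers X' 𝓑 → X.ncard ≤ X'.ncard) (hS : Covers S 𝓑) (hCX : Disjoint C X)
    (hC : ∀ c ∈ C, ∀ b, G.Adj c b → b ∈ X ∪ C) (hSC : Disjoint S C) (hYA : Y ⊆ A)
    (hA : ∀ a ∈ A, a ∉ Y → ∀ b, G.Adj a b → b ∈ A) (hSA : S ∩ A ⊆ Y) :
    (A ∩ X ∪ Y ∩ C).ncard ≤ Y.ncard := by
  rw [Set.disjoint_left] at hCX hSC
  -- Exchanging `(A ∩ X) \ Y` for `Y \ (X ∪ C)` still gives a cover: a missed member would be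
  -- confined to `A \ Y ∪ C`, where it cannot meet `S`. Minimality of `X` then compares the two
  -- exchanged sets.
  have hcov : Covers ((X \ ((A ∩ X) \ Y)) ∪ (Y \ (X ∪ C))) 𝓑 := by
    intro B hB
    by_contra! hno
    obtain ⟨x, hxB, hxX⟩ := hX B hB
    obtain ⟨z, hzB, hzS⟩ := hS B hB
    have := h𝓑 B hB (A \ Y ∪ C) ⟨x, hxB, by grind⟩ (by
      rintro a haB (haA | haC) b hbB hab
      · have := hA a haA.1 haA.2 b hab
        grind
      · have := hC a haC b hab
        grind)
    grind
  have h1 := hmin _ hcov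
  have h2 := Set.ncard_union_le (X \ ((A ∩ X) \ Y)) (Y \ (X ∪ C))
  have h3 := Set.ncard_sdiff_add_ncard_of_subset (s := (A ∩ X) \ Y) (t := X) (by grind)
  have h4 := Set.ncard_inter_add_ncard_sdiff_eq_ncard Y (X ∪ C)
  have h5 : A ∩ X ∪ Y ∩ C = Y ∩ (X ∪ C) ∪ ((A ∩ X) \ Y) := by grind
  have h6 := Set.ncard_union_le (Y ∩ (X ∪ C)) ((A ∩ X) \ Y)
  rw [h5]
  omega

/-- The inductive form of tree-width duality: if every bramble has a cover of size at most `k`,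
then for every bramble `𝓑` there is a tree decomposition no bag of which has size more than `k`
and covers `𝓑`. -/
lemma IsBramble.exists_rootedDecomposition [Finite V] {k : ℕ}
    (hk : ∀ 𝓑, G.IsBramble 𝓑 → ∃ X, Covers X 𝓑 ∧ X.ncard ≤ k) (𝓑 : Set (Set V))
    (h𝓑 : G.IsBramble 𝓑) :
    ∃ X 𝒳, G.RootedDecomposition Set.univ X 𝒳 ∧ ∀ Y ∈ 𝒳, k < Y.ncard → ¬ Covers Y 𝓑 := by
  -- The induction hypothesis concerns larger brambles, obtained by adding a component of `G - X`.
  induction 𝓑 using WellFoundedGT.induction with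
  | ind 𝓑 ih =>
  by_contra! hno
  obtain ⟨X, hX, hmin⟩ : ∃ X, Covers X 𝓑 ∧ ∀ X', Covers X' 𝓑 → X.ncard ≤ X'.ncard := by
    obtain ⟨X₀, hX₀, -⟩ := hk 𝓑 h𝓑
    exact Set.exists_min_image {X | Covers X 𝓑} Set.ncard (Set.toFinite _) ⟨X₀, hX₀⟩
  have hXk : X.ncard ≤ k := by
    obtain ⟨X₀, hX₀, h⟩ := hk 𝓑 h𝓑
    exact (hmin X₀ hX₀).trans h
  obtain ⟨𝒳, hd, hP⟩ := RootedDecomposition.of_componentAvoiding (G := G) (X := X)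
    (P := fun Y => k < Y.ncard → ¬ Covers Y 𝓑) (fun h => absurd hXk h.not_ge) (by
    intro a haX
    set C := G.componentAvoiding X a with hCdef
    have haC : a ∈ C := G.self_mem_componentAvoiding X a
    have hCX : Disjoint C X :=
      Set.disjoint_left.2 fun y hy => notMem_of_mem_componentAvoiding haX hy
    have hC : ∀ c ∈ C, ∀ b, G.Adj c b → b ∈ X ∪ C := fun c hc b hcb => by
      by_cases hb : b ∈ X
      · exact Or.inl hb
      · exact Or.inr (mem_componentAvoiding_of_adj hc hcb hb)
    by_cases htouch : ∀ B ∈ 𝓑, G.Touch C B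
    · have hC𝓑 : C ∉ 𝓑 := fun h => by
        obtain ⟨x, hx, hx'⟩ := hX C h
        exact Set.disjoint_left.1 hCX hx hx'
      have h𝓑' : G.IsBramble (insert C 𝓑) := by
        constructor
        · rintro B (rfl | hB)
          exacts [connectedOn_componentAvoiding X a, h𝓑.connectedOn B hB]
        · rintro B (rfl | hB) B' (rfl | hB')
          exacts [⟨a, haC, a, haC, Or.inl rfl⟩, htouch B' hB', (htouch B hB).symm,
            h𝓑.touch B hB B' hB']
      -- By `hno` some large bag `S` covers `𝓑`. It cannot cover `insert C 𝓑`, so it misses `C`;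
      -- rerooting there sets up the exchange.
      obtain ⟨R, 𝒳, hd, hP⟩ := ih (insert C 𝓑) (Set.ssubset_insert hC𝓑) h𝓑'
      obtain ⟨S, hS, hSk, hcov⟩ := hno R 𝒳 hd
      have hSC : Disjoint S C := by
        rw [Set.disjoint_left]
        intro x hx hxC
        refine hP S hS hSk ?_
        rintro B (rfl | hB)
        exacts [⟨x, hxC, hx⟩, hcov B hB]
      obtain ⟨𝒴, hd', hP'⟩ := (hd.reroot hS).pull (S := S) (X := X) (C := C)
        (Q := fun Y => k < Y.ncard → ¬ Covers Y 𝓑)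
        (P := fun Y => k < Y.ncard → ¬ Covers Y (insert C 𝓑))
        (by
          intro A Y hYA hY hA hSA hlt hW
          have hle := ncard_pull_le h𝓑.connectedOn hX hmin hcov hCX hC hSC hYA hA hSA
          obtain ⟨B, hB, hBY⟩ : ∃ B ∈ insert C 𝓑, ∀ x ∈ B, x ∉ Y := by
            by_contra! h
            exact hY (hlt.trans_le hle) h
          -- If `Y` misses `C`, the pulled bag lies in `X` and is small. If `Y` misses `B ∈ 𝓑`, then
          -- `B` is trapped in `A \ Y` and cannot meet `S`.
          rcases hB with rfl | hB
          · have : A ∩ X ∪ Y ∩ C ⊆ X := by grind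
            have := Set.ncard_le_ncard this
            omega
          · obtain ⟨x, hxB, hx⟩ := hW B hB
            obtain ⟨z, hzB, hz⟩ := hcov B hB
            have := h𝓑.connectedOn B hB A ⟨x, hxB, by grind⟩
              fun a ha haA b _ hab => hA a haA (hBY a ha) b hab
            grind) hP (by grind) (by grind)
      refine ⟨𝒴, ?_, hP'⟩
      convert hd' using 1 <;> grind
    · push Not at htouch
      obtain ⟨B, hB, hCB⟩ := htouch
      -- The bag `C ∪ N(C)` may be large, but it misses the member that `C` does not touch.
      refine ⟨{X} ∪ {{y | y ∈ C ∨ ∃ c ∈ C, G.Adj c y}}, ?_, ?_⟩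
      · have h := RootedDecomposition.glue (.leaf X)
          (.leaf (G := G) {y | y ∈ C ∨ ∃ c ∈ C, G.Adj c y}) (by grind) (by grind)
          (by have := fun a b => G.adj_comm a b; grind)
        convert h using 1
        ext y
        have := hC
        grind
      · rintro Y (rfl | rfl) hlt
        · omega
        · intro hcov
          obtain ⟨x, hxB, hx | ⟨c, hc, hcx⟩⟩ := hcov B hB
          · exact hCB ⟨x, hx, x, hxB, Or.inl rfl⟩
          · exact hCB ⟨c, hc, x, hxB, Or.inr hcx⟩)
  obtain ⟨Y, hY, hlt, hcov⟩ := hno X 𝒳 hd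
  exact hP Y hY hlt hcov

/-- Tree-width duality, the hard direction. -/
lemma exists_rootedDecomposition_of_forall_isBramble [Finite V] {k : ℕ}
    (hk : ∀ 𝓑, G.IsBramble 𝓑 → ∃ X, Covers X 𝓑 ∧ X.ncard ≤ k) :
    ∃ X 𝒳, G.RootedDecomposition Set.univ X 𝒳 ∧ ∀ Y ∈ 𝒳, Y.ncard ≤ k := by
  -- Every set covers the empty bramble, so no bag can be large.
  obtain ⟨X, 𝒳, hd, h⟩ := IsBramble.exists_rootedDecomposition hk ∅ ⟨by simp, by simp⟩
  exact ⟨X, 𝒳, hd, fun Y hY => not_lt.1 fun hlt => h Y hY hlt (by simp [Covers])⟩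

/-! ### Glued decompositions versus tree decompositions. -/

lemma IsTree.sum_sup_edge {ι κ : Type*} [Finite ι] [Finite κ] {S : SimpleGraph ι}
    {T : SimpleGraph κ} (hS : S.IsTree) (hT : T.IsTree) (r : ι) (s : κ) :
    ((S ⊕g T) ⊔ edge (.inl r) (.inr s)).IsTree := by
  rw [isTree_iff_connected_and_card] at hS hT ⊢
  refine ⟨hS.1.sum_sup_edge hT.1, ?_⟩
  have h : s(Sum.inl r, Sum.inr s) ∉ (S ⊕g T).edgeSet := by simp
  rw [edgeSet_sup, edgeSet_edge_of_ne Sum.inl_ne_inr, Set.union_singleton, Nat.card_coe_set_eq,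
    Set.ncard_insert_of_notMem h (Set.toFinite _), ← Nat.card_coe_set_eq,
    Nat.card_congr edgeSetSumEquiv, Nat.card_sum, Nat.card_sum]
  omega

/-- A walk inside `S` shortens to a path, and paths in a tree are unique. -/
lemma ConnectedOn.mem_of_mem_support {ι : Type*} {T : SimpleGraph ι} (hT : T.IsTree) {S : Set ι}
    (hS : T.ConnectedOn S) {i j k : ι} (p : T.Walk i j) (hp : p.IsPath) (hi : i ∈ S) (hj : j ∈ S)
    (hk : k ∈ p.support) : k ∈ S := by
  classical
  obtain ⟨q, hq⟩ : ∃ q : T.Walk i j, ∀ k ∈ q.support, k ∈ S := by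
    refine hS {j | ∃ q : T.Walk i j, ∀ k ∈ q.support, k ∈ S} ⟨i, hi, .nil, by simpa⟩ ?_ hj
    rintro a - ⟨q, hq⟩ b hb hab
    refine ⟨q.concat hab, fun k hk => ?_⟩
    rw [Walk.support_concat] at hk
    simp only [List.mem_append, List.mem_singleton] at hk
    rcases hk with hk | rfl
    exacts [hq k hk, hb]
  have h := (hT.isAcyclic.subsingleton_path i j).elim ⟨p, hp⟩ q.toPath
  have h' : p = q.toPath.1 := congrArg Subtype.val h
  exact hq k (q.support_toPath_subset_support (h' ▸ hk))

namespace RootedDecomposition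

/-- Each `glue` joins the two roots by an edge. A vertex of both halves lies in both root bags, so
its nodes stay connected across that edge. -/
lemma exists_tree {A X : Set V} {𝒳 : Set (Set V)} (h : G.RootedDecomposition A X 𝒳) :
    ∃ (ι : Type) (_ : Fintype ι) (T : SimpleGraph ι) (bag : ι → Set V) (r : ι), T.IsTree ∧
      bag r = X ∧ (∀ i, bag i ∈ 𝒳) ∧ (∀ v ∈ A, ∃ i, v ∈ bag i) ∧
      (∀ u ∈ A, ∀ v ∈ A, G.Adj u v → ∃ i, u ∈ bag i ∧ v ∈ bag i) ∧
      ∀ v, T.ConnectedOn {i | v ∈ bag i} := by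
  induction h with
  | leaf X =>
    refine ⟨Unit, inferInstance, ⊥, fun _ => X, (), .of_subsingleton, rfl, fun _ => rfl,
      fun v hv => ⟨(), hv⟩, fun u hu v hv _ => ⟨(), hu, hv⟩, ?_⟩
    rintro v U ⟨⟨⟩, _, hU⟩ _ ⟨⟩ _
    exact hU
  | @glue A B X Y 𝒳 𝒴 hA hB hX hY hadj ihA ihB =>
    obtain ⟨ι, _, S, f, r, hS, hr, hf, hfA, hfadj, hfc⟩ := ihA
    obtain ⟨κ, _, T, g, s, hT, hs, hg, hgB, hgadj, hgc⟩ := ihB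
    have hfA' : ∀ i, f i ⊆ A := fun i => hA.subset_of_mem _ (hf i)
    have hgB' : ∀ i, g i ⊆ B := fun i => hB.subset_of_mem _ (hg i)
    refine ⟨ι ⊕ κ, inferInstance, (S ⊕g T) ⊔ edge (.inl r) (.inr s), Sum.elim f g, .inl r,
      hS.sum_sup_edge hT r s, hr, ?_, ?_, ?_, ?_⟩
    · rintro (i | i)
      exacts [Or.inl (hf i), Or.inr (hg i)]
    · rintro v (hv | hv)
      · obtain ⟨i, hi⟩ := hfA v hv
        exact ⟨.inl i, hi⟩
      · obtain ⟨i, hi⟩ := hgB v hv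
        exact ⟨.inr i, hi⟩
    · intro u hu v hv huv
      by_cases h : u ∈ A ∧ v ∈ A
      · obtain ⟨i, hi⟩ := hfadj u h.1 v h.2 huv
        exact ⟨.inl i, hi⟩
      · have := hadj u
        have := hadj v
        have := huv.symm
        obtain ⟨i, hi⟩ := hgadj u (by grind) v (by grind) huv
        exact ⟨.inr i, hi⟩
    · intro v U hU hUcl
      have hl : ∀ i, v ∈ f i → .inl i ∈ U → ∀ j, v ∈ f j → .inl j ∈ U := fun i hi hiU j hj =>
        hfc v (Sum.inl ⁻¹' U) ⟨i, hi, hiU⟩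
          (fun a ha haU b hb hab => hUcl (.inl a) ha haU (.inl b) hb (Or.inl hab)) hj
      have hr' : ∀ i, v ∈ g i → .inr i ∈ U → ∀ j, v ∈ g j → .inr j ∈ U := fun i hi hiU j hj =>
        hgc v (Sum.inr ⁻¹' U) ⟨i, hi, hiU⟩
          (fun a ha haU b hb hab => hUcl (.inr a) ha haU (.inr b) hb (Or.inl hab)) hj
      have hlr : ∀ i j, v ∈ f i → v ∈ g j → v ∈ f r ∧ v ∈ g s := fun i j hi hj => by
        rw [hr, hs]
        exact ⟨hX ⟨hfA' i hi, hgB' j hj⟩, hY ⟨hfA' i hi, hgB' j hj⟩⟩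
      have hedge : ((S ⊕g T) ⊔ edge (.inl r) (.inr s)).Adj (.inl r) (.inr s) :=
        Or.inr (by simp [edge_adj])
      obtain ⟨i | i, hi, hiU⟩ := hU
      · rintro (j | j) hj
        · exact hl i hi hiU j hj
        · obtain ⟨h₁, h₂⟩ := hlr i j hi hj
          exact hr' s h₂ (hUcl (.inl r) h₁ (hl i hi hiU r h₁) (.inr s) h₂ hedge) j hj
      · rintro (j | j) hj
        · obtain ⟨h₁, h₂⟩ := hlr j i hj hi
          exact hl r h₁ (hUcl (.inr s) h₂ (hr' i hi hiU s h₂) (.inl r) h₁ hedge.symm) j hj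
        · exact hr' i hi hiU j hj

lemma treewidth_le [Finite V] {X : Set V} {𝒳 : Set (Set V)} {k : ℕ}
    (h : G.RootedDecomposition Set.univ X 𝒳) (hk : ∀ Y ∈ 𝒳, Y.ncard ≤ k) :
    G.treewidth ≤ k - 1 := by
  classical
  have := Fintype.ofFinite V
  obtain ⟨ι, _, T, bag, r, hT, -, hbag, hcov, hadj, hconn⟩ := h.exists_tree
  let D : G.TreeDecomposition ι :=
    { tree := T
      isTree := hT
      bag := fun i => (bag i).toFinset
      adj_mem_bag := fun u v huv => by simpa using hadj u trivial v trivial huv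
      mem_bag_of_mem_path := fun v i j p hp hi hj k hk => by
        simp only [Set.mem_toFinset] at hi hj ⊢
        exact (hconn v).mem_of_mem_support hT p hp hi hj hk
      exists_mem_bag := fun v => by simpa using hcov v trivial }
  refine (Nat.sInf_le ⟨ι, inferInstance, D, rfl⟩ : G.treewidth ≤ D.width).trans (Nat.sub_le_sub_right ?_ 1)
  refine Finset.sup_le fun i _ => ?_
  rw [← Set.ncard_eq_toFinset_card']
  exact hk _ (hbag i)

/-- Induction by deleting a leaf: whatever its bag shares with the rest lies in the bag of its
neighbour, where it can be attached. -/
lemma of_tree {ι : Type*} [Finite ι] {T : SimpleGraph ι} (hT : T.IsTree) (bag : ι → Set V)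
    (hadj : ∀ i j, ∀ u ∈ bag i, ∀ v ∈ bag j, G.Adj u v → ∃ k, u ∈ bag k ∧ v ∈ bag k)
    (hpath : ∀ (v : V) (i j : ι) (p : T.Walk i j), p.IsPath → v ∈ bag i → v ∈ bag j →
      ∀ k ∈ p.support, v ∈ bag k) :
    ∃ X, G.RootedDecomposition (⋃ i, bag i) X (Set.range bag) := by
  classical
  induction hn : Nat.card ι generalizing ι with
  | zero =>
    have := hT.connected.nonempty
    exact absurd hn Nat.card_pos.ne'
  | succ n ih =>
    have := Fintype.ofFinite ι
    have := hT.connected.nonempty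
    rcases subsingleton_or_nontrivial ι with _ | _
    · obtain ⟨i⟩ := this
      refine ⟨bag i, ?_⟩
      convert leaf (G := G) (bag i) using 1
      · exact Set.Subset.antisymm (Set.iUnion_subset fun j => by rw [Subsingleton.elim j i])
          (Set.subset_iUnion bag i)
      · exact Set.eq_singleton_iff_unique_mem.2
          ⟨⟨i, rfl⟩, by rintro _ ⟨j, rfl⟩; rw [Subsingleton.elim j i]⟩
    obtain ⟨l, hl⟩ := hT.exists_vert_degree_one_of_nontrivial
    have hT' : (T.induce {l}ᶜ).IsTree :=
      ⟨hT.connected.induce_compl_singleton_of_degree_eq_one hl, hT.isAcyclic.induce _⟩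
    obtain ⟨p, hlp, hp⟩ := degree_eq_one_iff_existsUnique_adj.mp hl
    have hpl : p ≠ l := hlp.ne'
    have hbagp : ∀ i, i ≠ l → ∀ v ∈ bag i, v ∈ bag l → v ∈ bag p := by
      intro i hi v hvi hvl
      obtain ⟨q, hq⟩ := hT.connected.exists_isPath l i
      have hnil : ¬ q.Nil := Walk.not_nil_of_ne hi.symm
      have : q.snd = p := hp _ (q.adj_snd hnil)
      exact this ▸ hpath v l i q hq hvl hvi q.snd (q.getVert_mem_support 1)
    obtain ⟨X, hX⟩ := ih hT' (fun i => bag i) (by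
        rintro ⟨i, hi⟩ ⟨j, hj⟩ u hu v hv huv
        obtain ⟨k, hk⟩ := hadj i j u hu v hv huv
        by_cases hkl : k = l
        · subst hkl
          exact ⟨⟨p, hpl⟩, hbagp i hi u hu hk.1, hbagp j hj v hv hk.2⟩
        · exact ⟨⟨k, hkl⟩, hk⟩)
      (by
        intro v i j q hq hi hj k hk
        refine hpath v i j (q.map (Embedding.induce (G := T) {l}ᶜ).toHom)
          ((Walk.isPath_map_iff_of_injective (Embedding.induce (G := T) {l}ᶜ).injective).2 hq)
          hi hj k ?_
        have h := List.mem_map_of_mem (f := (Embedding.induce (G := T) {l}ᶜ).toHom) hk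
        rwa [← Walk.support_map] at h)
      (by
        have := Nat.card_coe_set_eq ({l}ᶜ : Set ι)
        rw [Set.ncard_compl, Set.ncard_singleton] at this
        omega)
    have hsub : (⋃ i : ({l}ᶜ : Set ι), bag i) ∩ bag l ⊆ bag p := by
      rintro v ⟨hv, hvl⟩
      obtain ⟨⟨i, hi⟩, hvi⟩ := Set.mem_iUnion.1 hv
      exact hbagp i hi v hvi hvl
    have h := hX.attach (leaf (G := G) (bag l)) (X := bag p) ⟨⟨p, hpl⟩, rfl⟩ hsub
      Set.inter_subset_right (by
        intro a ha hal b hb hbA hab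
        obtain ⟨⟨i, hi⟩, hai⟩ := Set.mem_iUnion.1 ha
        obtain ⟨k, hk⟩ := hadj i l a hai b hb hab
        by_cases hkl : k = l
        · exact hal (hkl ▸ hk.1)
        · exact hbA (Set.mem_iUnion.2 ⟨⟨k, hkl⟩, hk.2⟩))
    refine ⟨X, ?_⟩
    convert h using 1
    · ext v
      simp only [Set.mem_iUnion, Set.mem_union, Subtype.exists, Set.mem_compl_iff,
        Set.mem_singleton_iff]
      grind
    · ext Y
      simp only [Set.mem_range, Set.mem_union, Subtype.exists, Set.mem_compl_iff,
        Set.mem_singleton_iff]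
      grind

end RootedDecomposition

lemma TreeDecomposition.exists_rootedDecomposition {ι : Type*} [Finite ι]
    (D : G.TreeDecomposition ι) :
    ∃ X, G.RootedDecomposition Set.univ X (Set.range fun i => (D.bag i : Set V)) := by
  have h : (⋃ i, (D.bag i : Set V)) = Set.univ :=
    Set.eq_univ_of_forall fun v => by simpa using D.exists_mem_bag v
  rw [← h]
  exact RootedDecomposition.of_tree D.isTree _ (fun _ _ u _ v _ huv => D.adj_mem_bag u v huv) D.mem_bag_of_mem_path

/-- The easy direction of tree-width duality: every bramble has a cover of size at most the
tree-width plus one. -/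
lemma IsBramble.exists_covers_ncard_le [Finite V] {𝓑 : Set (Set V)} (h : G.IsBramble 𝓑) :
    ∃ X, Covers X 𝓑 ∧ X.ncard ≤ G.treewidth + 1 := by
  obtain ⟨ι, _, D, hD⟩ := exists_treeDecomposition G
  obtain ⟨X, hX⟩ := D.exists_rootedDecomposition
  obtain ⟨_, ⟨i, rfl⟩, hcov⟩ := hX.exists_mem_covers h
  refine ⟨_, hcov, ?_⟩
  have := Finset.le_sup (f := fun i => (D.bag i).card) (Finset.mem_univ i)
  rw [← hD, TreeDecomposition.width, Set.ncard_coe_finset]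
  omega

/-- The hard direction of tree-width duality: if the tree-width is positive, then some bramble has
no cover of size at most the tree-width. -/
lemma exists_isBramble_forall_covers [Finite V] (h : 0 < G.treewidth) :
    ∃ 𝓑, G.IsBramble 𝓑 ∧ ∀ X, Covers X 𝓑 → G.treewidth < X.ncard := by
  by_contra! hno
  obtain ⟨X, 𝒳, hd, hk⟩ := exists_rootedDecomposition_of_forall_isBramble hno
  have := hd.treewidth_le hk
  omega

variable {W : Type*} {H : SimpleGraph W}

/-! ### Odd cycles. -/

/-- `c` winds around a closed walk of length `n`. -/
def IsClosedSequence (H : SimpleGraph W) (n : ℕ) (c : ℕ → W) : Prop :=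
  (∀ i, H.Adj (c i) (c (i + 1))) ∧ ∀ i, c (i + n) = c i

lemma isClosedSequence_mod {n : ℕ} (hn : 0 < n) {c : ℕ → W}
    (hc : ∀ i < n, H.Adj (c i) (c (i + 1))) (hcn : c n = c 0) :
    H.IsClosedSequence n fun i => c (i % n) := by
  refine ⟨fun i => ?_, fun i => by simp⟩
  have hlt := Nat.mod_lt i hn
  have h := hc (i % n) hlt
  have hmod : (i + 1) % n = (i % n + 1) % n := by simp
  dsimp only
  rw [hmod]
  rcases (Nat.succ_le_of_lt hlt).eq_or_lt with h' | h'
  · have h' : i % n + 1 = n := h'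
    rw [h', Nat.mod_self, ← hcn]
    rwa [h'] at h
  · rwa [Nat.mod_eq_of_lt h']

lemma exists_isClosedSequence_odd (h : ¬ H.IsBipartite) :
    ∃ n c, Odd n ∧ H.IsClosedSequence n c := by
  have h' : ¬ H.Colorable 2 := h
  rw [two_colorable_iff_forall_loop_even] at h'
  push Not at h'
  obtain ⟨u, w, hw⟩ := h'
  rw [Nat.not_even_iff_odd] at hw
  exact ⟨w.length, _, hw, isClosedSequence_mod (c := w.getVert) hw.pos
    (fun i hi => w.adj_getVert_succ hi) (by simp)⟩

/-- A nonbipartite graph contains an odd cycle. -/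
lemma exists_isClosedSequence_odd_injOn (h : ¬ H.IsBipartite) :
    ∃ n c, Odd n ∧ H.IsClosedSequence n c ∧ Set.InjOn c (Set.Iio n) := by
  classical
  have hex : ∃ n, ∃ c, Odd n ∧ H.IsClosedSequence n c := exists_isClosedSequence_odd h
  obtain ⟨c, hodd, hc⟩ := Nat.find_spec hex
  set n := Nat.find hex
  have hmin : ∀ m < n, Odd m → ∀ c, ¬ H.IsClosedSequence m c := fun m hm hm' c hc =>
    Nat.find_min hex hm ⟨c, hm', hc⟩
  -- A repeated vertex splits a shortest odd closed walk into two shorter ones, one of them odd.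
  have key : ∀ i j, i < j → j < n → c i ≠ c j := by
    intro i j hij hj heq
    have h₁ : H.IsClosedSequence (j - i) fun m => c (i + m % (j - i)) :=
      isClosedSequence_mod (c := fun m => c (i + m)) (by omega)
        (fun m _ => hc.1 (i + m)) (by simp [Nat.add_sub_cancel' hij.le, heq])
    have h₂ : H.IsClosedSequence (n - (j - i)) fun m => c (j + m % (n - (j - i))) :=
      isClosedSequence_mod (c := fun m => c (j + m)) (by omega)
        (fun m _ => hc.1 (j + m)) (by
          rw [show j + (n - (j - i)) = i + n by omega, hc.2, heq, add_zero])
    rcases Nat.even_or_odd (j - i) with he | ho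
    · exact hmin _ (by omega) (Nat.Odd.sub_even (by omega) hodd he) _ h₂
    · exact hmin _ (by omega) ho _ h₁
  refine ⟨n, c, hodd, hc, fun i hi j hj hij => ?_⟩
  rcases lt_trichotomy i j with hlt | rfl | hlt
  exacts [absurd hij (key i j hlt hj), rfl, absurd hij.symm (key j i hlt hi)]

namespace IsClosedSequence

variable {n : ℕ} {c : ℕ → W}

lemma add_mul (hc : H.IsClosedSequence n c) (i m : ℕ) : c (i + m * n) = c i := by
  induction m with
  | zero => simp
  | succ m ih => rw [Nat.succ_mul, ← add_assoc, hc.2, ih]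

lemma mod (hc : H.IsClosedSequence n c) (i : ℕ) : c (i % n) = c i := by
  conv_rhs => rw [← Nat.mod_add_div' i n]
  exact (hc.add_mul _ _).symm

/-- Steps of length two around an odd closed walk reach every position, even without using the step
across one given position. -/
lemma forall_of_step_two (hc : H.IsClosedSequence n c) (hn : Odd n) {P : W → Prop} (j : ℕ)
    (hstep : ∀ i, ¬ (i + 1) ≡ j [MOD n] → (P (c i) ↔ P (c (i + 2)))) (h : ∃ i, P (c i)) :
    ∀ i, P (c i) := by
  have hpos := hn.pos
  -- Starting just after `j`, the first `n - 1` double steps never cross `j`, because `n ∣ 2 * (m +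
  -- 1)` forces `n ∣ m + 1`.
  have h1 : ∀ m < n, (P (c (j + 1)) ↔ P (c (j + 1 + 2 * m))) := by
    intro m
    induction m with
    | zero => simp
    | succ m ih =>
      intro hm
      rw [ih (by omega), hstep]
      · rfl
      · intro hmod
        have h0 : j + 2 * (m + 1) ≡ j + 0 [MOD n] := by
          convert hmod using 1 <;> ring
        have h0 := (Nat.modEq_zero_iff_dvd.1 (Nat.ModEq.add_left_cancel' j h0))
        have := (Nat.Coprime.dvd_mul_left (Nat.coprime_two_right.2 hn)).1 h0
        exact absurd (Nat.le_of_dvd (by omega) this) (by omega)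
  have h2 : ∀ i, P (c i) ↔ P (c (j + 1)) := by
    intro i
    obtain ⟨t, ht⟩ := hn
    obtain ⟨a, ha⟩ : ∃ a, (j + 1 + 2 * a) ≡ i [MOD n] := by
      -- Modulo `n = 2 * t + 1`, `t + 1` inverts 2 and `n - 1` is `-1`: this is `(i - (j + 1)) / 2`.
      refine ⟨(t + 1) * (i + (n - 1) * (j + 1)), ?_⟩
      have : j + 1 + 2 * ((t + 1) * (i + (n - 1) * (j + 1))) =
          i + n * (i + (j + 1) * (n)) := by
        obtain ⟨m, rfl⟩ : ∃ m, n = m + 1 := ⟨n - 1, by omega⟩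
        have : m = 2 * t := by omega
        subst this
        simp only [Nat.add_sub_cancel]
        ring
      rw [this]
      simp [Nat.ModEq]
    rw [h1 (a % n) (Nat.mod_lt _ hpos)]
    have : c i = c (j + 1 + 2 * (a % n)) := by
      rw [← hc.mod i, ← hc.mod (j + 1 + 2 * (a % n))]
      congr 1
      exact (ha.symm.trans (((Nat.mod_modEq a n).symm.mul_left 2).add_left (j + 1)))
    rw [this]
  obtain ⟨i, hi⟩ := h
  exact fun i' => (h2 i').2 ((h2 i).1 hi)

end IsClosedSequence

/-! ### Lifting brambles to the tensor product. -/

lemma ConnectedOn.exists_adj {B : Set V} (hB : G.ConnectedOn B) {b b' : V} (hb : b ∈ B)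
    (hb' : b' ∈ B) (hne : b' ≠ b) : ∃ a ∈ B, G.Adj b a := by
  by_contra! hno
  exact hne (hB {b} ⟨b, hb, rfl⟩ (by rintro _ - rfl a ha haa; exact absurd haa (hno a ha)) hb')

/-- The product of a connected set having at least two elements with an odd closed walk is
connected. -/
lemma ConnectedOn.prod_range {n : ℕ} {c : ℕ → W} (hc : H.IsClosedSequence n c) (hn : Odd n)
    {B : Set V} (hB : G.ConnectedOn B) (hnt : B.Nontrivial) :
    (G.tensorProduct H).ConnectedOn (B ×ˢ Set.range c) := by
  rintro U ⟨⟨b, _⟩, ⟨hb, i, rfl⟩, hbU⟩ hU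
  have hrow : ∀ b ∈ B, (∃ i, (b, c i) ∈ U) → ∀ i, (b, c i) ∈ U := by
    intro b hb hex
    obtain ⟨b', hb', hne⟩ := hnt.exists_ne b
    obtain ⟨a, ha, hba⟩ := hB.exists_adj hb hb' hne
    -- Every double step is available here, so the excluded position 0 is arbitrary.
    refine hc.forall_of_step_two hn (P := fun w => (b, w) ∈ U) 0 (fun i _ => ?_) hex
    have h₁ := hc.1 i
    have h₂ := hc.1 (i + 1)
    constructor
    · intro h
      have h := hU _ ⟨hb, i, rfl⟩ h (a, c (i + 1)) ⟨ha, i + 1, rfl⟩ ⟨hba, h₁⟩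
      exact hU _ ⟨ha, i + 1, rfl⟩ h (b, c (i + 2)) ⟨hb, i + 2, rfl⟩ ⟨hba.symm, h₂⟩
    · intro h
      have h := hU _ ⟨hb, i + 2, rfl⟩ h (a, c (i + 1)) ⟨ha, i + 1, rfl⟩ ⟨hba, h₂.symm⟩
      exact hU _ ⟨ha, i + 1, rfl⟩ h (b, c i) ⟨hb, i, rfl⟩ ⟨hba.symm, h₁.symm⟩
  have := hB {b | ∀ i, (b, c i) ∈ U} ⟨b, hb, hrow b hb ⟨i, hbU⟩⟩
    fun a ha haU a' ha' haa' => hrow a' ha'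
      ⟨1, hU _ ⟨ha, 0, rfl⟩ (haU 0) (a', c 1) ⟨ha', 1, rfl⟩ ⟨haa', hc.1 0⟩⟩
  rintro ⟨a, _⟩ ⟨ha, i, rfl⟩
  exact this ha i

/-- If at all but one position `j` of an odd closed walk some vertex over a neighbor of `v` avoids
`S`, then the copy of the closed walk over `v` extends to a connected set avoiding `S`. -/
lemma exists_connectedOn_singleton {n : ℕ} {c : ℕ → W} (hc : H.IsClosedSequence n c)
    (hn : Odd n) {S : Set (V × W)} {v : V} (hv : ∀ i, (v, c i) ∉ S) (j : ℕ)
    (hj : ∀ i, ¬ i ≡ j [MOD n] → ∃ u, G.Adj v u ∧ (u, c i) ∉ S) :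
    ∃ D, (G.tensorProduct H).ConnectedOn D ∧ {v} ×ˢ Set.range c ⊆ D ∧ ∀ x ∈ D, x ∉ S := by
  refine ⟨{x | x ∉ S ∧ (x.1 = v ∨ G.Adj v x.1) ∧ x.2 ∈ Set.range c}, ?_, ?_, fun x hx => hx.1⟩
  · rintro U ⟨⟨u, _⟩, ⟨huS, huv, i, rfl⟩, huU⟩ hU
    have hmem : ∀ i, (v, c i) ∈ {x : V × W | x ∉ S ∧ (x.1 = v ∨ G.Adj v x.1) ∧
      x.2 ∈ Set.range c} := fun i => ⟨hv i, Or.inl rfl, i, rfl⟩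
    have hex : ∃ i, (v, c i) ∈ U := by
      rcases huv with rfl | huv
      · exact ⟨i, huU⟩
      · exact ⟨i + 1, hU _ ⟨huS, Or.inr huv, i, rfl⟩ huU _ (hmem (i + 1)) ⟨huv.symm, hc.1 i⟩⟩
    have hrow : ∀ i, (v, c i) ∈ U := by
      refine hc.forall_of_step_two hn (P := fun w => (v, w) ∈ U) j (fun i hi => ?_) hex
      obtain ⟨a, hva, haS⟩ := hj _ hi
      have ha : (a, c (i + 1)) ∈ {x : V × W | x ∉ S ∧ (x.1 = v ∨ G.Adj v x.1) ∧
        x.2 ∈ Set.range c} := ⟨haS, Or.inr hva, i + 1, rfl⟩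
      constructor
      · intro h
        exact hU _ ha (hU _ (hmem i) h _ ha ⟨hva, hc.1 i⟩) _ (hmem (i + 2))
          ⟨hva.symm, hc.1 (i + 1)⟩
      · intro h
        exact hU _ ha (hU _ (hmem (i + 2)) h _ ha ⟨hva, (hc.1 (i + 1)).symm⟩) _ (hmem i)
          ⟨hva.symm, (hc.1 i).symm⟩
    rintro ⟨a, _⟩ ⟨haS, rfl | ha, k, rfl⟩
    · exact hrow k
    -- With `n = 2 * m + 1`, position `k + 2 * m` is the cyclic predecessor of `k`.
    · obtain ⟨m, rfl⟩ := hn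
      have hadj := hc.1 (k + 2 * m)
      rw [show k + 2 * m + 1 = k + (2 * m + 1) by ring, hc.2] at hadj
      exact hU _ (hmem (k + 2 * m)) (hrow _) _ ⟨haS, Or.inr ha, k, rfl⟩ ⟨ha, hadj⟩
  · rintro ⟨_, _⟩ ⟨rfl, i, rfl⟩
    exact ⟨hv i, Or.inl rfl, i, rfl⟩

/-- A set too small to contain two copies of the neighborhood of `v` leaves a vertex over a
neighbor of `v` at all but one position of an odd cycle. -/
lemma exists_forall_exists_notMem [Finite V] [Finite W] {n : ℕ} {c : ℕ → W}
    (hc : H.IsClosedSequence n c) (hn : 0 < n) (hinj : Set.InjOn c (Set.Iio n)) {S : Set (V × W)}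
    {v : V} (hS : S.ncard < 2 * (G.neighborSet v).ncard) :
    ∃ j, ∀ i, ¬ i ≡ j [MOD n] → ∃ u, G.Adj v u ∧ (u, c i) ∉ S := by
  by_contra! hno
  -- The 0 is arbitrary: it yields one filled position `i`, and `hno i` a different one. Their
  -- fibres are disjoint.
  obtain ⟨i, -, hi⟩ := hno 0
  obtain ⟨k, hki, hk⟩ := hno i
  have hne : c k ≠ c i := by
    rw [← hc.mod k, ← hc.mod i]
    exact fun h => hki (hinj (Nat.mod_lt _ hn) (Nat.mod_lt _ hn) h)
  have hsub : ((fun u => (u, c i)) '' G.neighborSet v) ∪ ((fun u => (u, c k)) '' G.neighborSet v)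
      ⊆ S := by
    rintro _ (⟨u, hu, rfl⟩ | ⟨u, hu, rfl⟩)
    exacts [hi u hu, hk u hu]
  have hle := Set.ncard_le_ncard hsub
  rw [Set.ncard_union_eq, Set.ncard_image_of_injective _ (Prod.mk_left_injective _),
    Set.ncard_image_of_injective _ (Prod.mk_left_injective _)] at hle
  · omega
  · rw [Set.disjoint_left]
    rintro _ ⟨u, -, rfl⟩ ⟨u', -, h⟩
    exact hne (congrArg Prod.snd h)

/-- A bramble of `G` lifts to a bramble of the tensor product with a graph containing a closed
walk. -/
lemma IsBramble.tensorProduct {n : ℕ} {c : ℕ → W} (hc : H.IsClosedSequence n c)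
    {𝓑 : Set (Set V)} (h : G.IsBramble 𝓑) :
    (G.tensorProduct H).IsBramble
      {D | (G.tensorProduct H).ConnectedOn D ∧ ∃ B ∈ 𝓑, B ×ˢ Set.range c ⊆ D} := by
  refine ⟨fun D hD => hD.1, ?_⟩
  rintro D ⟨-, B, hB, hBD⟩ D' ⟨-, B', hB', hBD'⟩
  obtain ⟨a, ha, b, hb, rfl | hab⟩ := h.touch B hB B' hB'
  · exact ⟨(a, c 0), hBD ⟨ha, 0, rfl⟩, (a, c 0), hBD' ⟨hb, 0, rfl⟩, Or.inl rfl⟩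
  · exact ⟨(a, c 0), hBD ⟨ha, 0, rfl⟩, (b, c 1), hBD' ⟨hb, 1, rfl⟩, Or.inr ⟨hab, hc.1 0⟩⟩

/-- If every cover of a bramble of `G` has more than `w` elements, then so has every cover of the
lifted bramble. -/
lemma lt_ncard_of_covers_tensorProduct [Finite V] [Finite W] {n w : ℕ} {c : ℕ → W}
    (hc : H.IsClosedSequence n c) (hn : Odd n) (hinj : Set.InjOn c (Set.Iio n)) (hw : 0 < w)
    {𝓑 : Set (Set V)} (h : G.IsBramble 𝓑) (hcov : ∀ X, Covers X 𝓑 → w < X.ncard)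
    {S : Set (V × W)}
    (hS : Covers S {D | (G.tensorProduct H).ConnectedOn D ∧ ∃ B ∈ 𝓑, B ×ˢ Set.range c ⊆ D}) :
    w < S.ncard := by
  by_contra! hle
  obtain ⟨B, hB, hBS⟩ : ∃ B ∈ 𝓑, ∀ x ∈ B, x ∉ Prod.fst '' S := by
    by_contra! hno
    have := hcov _ hno
    have := Set.ncard_image_le (f := Prod.fst) (s := S) (Set.toFinite S)
    omega
  suffices H : ∃ D, (G.tensorProduct H).ConnectedOn D ∧ B ×ˢ Set.range c ⊆ D ∧ ∀ x ∈ D, x ∉ S by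
    obtain ⟨D, hD, hBD, hDS⟩ := H
    obtain ⟨x, hxD, hxS⟩ := hS D ⟨hD, B, hB, hBD⟩
    exact hDS x hxD hxS
  have hBS' : ∀ v ∈ B, ∀ y, (v, y) ∉ S := fun v hv y hy => hBS v hv ⟨_, hy, rfl⟩
  rcases B.subsingleton_or_nontrivial with hsub | hnt
  · obtain ⟨v, hv, -⟩ := h.touch B hB B hB
    obtain rfl : B = {v} := hsub.eq_singleton_of_mem hv
    -- Every member touches `{v}`, so the degree is at least `w`; since `w > 0`, `|S| ≤ w` is less
    -- than twice the degree.
    have hlt : w < (insert v (G.neighborSet v)).ncard := hcov _ fun B' hB' => by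
      obtain ⟨_, rfl, b, hb, rfl | hab⟩ := h.touch _ hB B' hB'
      exacts [⟨_, hb, Or.inl rfl⟩, ⟨b, hb, Or.inr hab⟩]
    have := Set.ncard_insert_le v (G.neighborSet v)
    obtain ⟨j, hj⟩ := exists_forall_exists_notMem (G := G) (S := S) (v := v) hc hn.pos hinj
      (by omega)
    exact exists_connectedOn_singleton hc hn (fun i => hBS' v hv _) j hj
  · exact ⟨_, (h.connectedOn B hB).prod_range hc hn hnt, subset_rfl,
      fun x hx => hBS' x.1 hx.1 x.2⟩

end SimpleGraph

theorem lemmaA10 {V W : Type*} [Finite V] [Finite W] (G : SimpleGraph V) (H : SimpleGraph W)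
    (hG : G.Connected) (hH : H.Connected) (hH' : ¬ H.IsBipartite) :
    G.treewidth ≤ (G.tensorProduct H).treewidth := by
  rcases Nat.eq_zero_or_pos G.treewidth with h0 | hpos
  · omega
  obtain ⟨n, c, hn, hc, hinj⟩ := SimpleGraph.exists_isClosedSequence_odd_injOn hH'
  obtain ⟨𝓑, h𝓑, hcov⟩ := SimpleGraph.exists_isBramble_forall_covers hpos
  obtain ⟨S, hS, hle⟩ := (h𝓑.tensorProduct hc).exists_covers_ncard_le
  have := SimpleGraph.lt_ncard_of_covers_tensorProduct hc hn hinj hpos h𝓑 hcov hS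
  omega
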